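/- A slat-doctrine is a functor $P:\mathcal C^{\mathrm{op}}\to\mathbf{Pos}$, where $\mathcal C$ is a category with finite products; write $P_f$ for the reindexing map along $f$. Slat-doctrines form a 2-category $\mathbf{SD}$. A 1-cell $P\to R$ is a pair $(F,b)$ with $F:\mathcal C\to\mathcal D$ a functor preserving finite products and $b:P\to R\circ F^{\mathrm{op}}$ a natural transformation. A 2-cell $(F,b)\to(G,c)$ is a natural transformation $\theta:F\to G$ with $b_A(\alpha)\le R_{\theta_A}(c_A(\alpha))$ for all $A$ and all $\alpha\in P(A)$. Let $\mathbf{SD}_{\exp}$ be the 2-full sub-2-category of the slat-doctrines whose base category has exponents (is cartesian closed), with the 1-cells $(F,b)$ for which $F$ preserves exponents. A slat-doctrine $P$ is universal if for every product projection $p:X\to A$ the map $P_p:P(A)\to P(X)$ has a right adjoint $\forall_p$, and the Beck-Chevalley equality $P_f\forall_p=\forall_{p'}P_{f'}$ holds for every pullback square $p f'=f p'$ in which $p$ and $p'$ are product projections. A 1-cell $(F,b)$ between universal slat-doctrines preserves the universal structure if $b_A\forall_p=\forall_{Fp}\,b_X$ for every product projection $p:X\to A$. Let $\mathbf{UD}_{\exp}$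 be the 2-full sub-2-category of $\mathbf{SD}_{\exp}$ of the universal slat-doctrines, with the 1-cells that preserve the universal structure. The existential completion $P^{\mathrm{ex}}$ of $P$ has the same base as $P$, and $P^{\mathrm{ex}}(A)$ is the poset reflection of the preorder of triples $(A,B,\alpha)$ with $\alpha\in P(A\times B)$, where $(A,B,\alpha)\le(A,C,\beta)$ iff $\alpha\le P_{\langle \mathrm{pr}_A,f\rangle}(\beta)$ for some $f:A\times B\to C$; reindexing along $f:A\to C$ sends $(C,B,\gamma)$ to $(A,B,P_{f\times 1_B}(\gamma))$. It underlies a 2-monad $T^{\mathrm{ex}}$ on $\mathbf{SD}$, which restricts to $\mathbf{SD}_{\exp}$. On 1-cells $T^{\mathrm{ex}}(F,b)=(F,\bar b)$ with $\bar b_A(A,B,\alpha)=(FA,FB,R_m\,b_{A\times B}(\alpha))$, where $m:FA\times FB\cong F(A\times B)$ is the canonical isomorphism, and $T^{\mathrm{ex}}(\theta)=\theta$ on 2-cells. The unit $\eta_P:P\to P^{\mathrm{ex}}$ is the identity functor together with $\alpha\mapsto(A,1,\alpha)$ (using $A\times 1\cong A$). The multiplication $\mu_P:(P^{\mathrm{ex}})^{\mathrm{ex}}\to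 P^{\mathrm{ex}}$ is the identity functor together with $(A,B,x)\mapsto\exists^{\mathrm{ex}}_{\mathrm{pr}_A}(x)$ for $x\in P^{\mathrm{ex}}(A\times B)$, where $\exists^{\mathrm{ex}}_{\mathrm{pr}_A}(A\times B,C,\gamma)=(A,B\times C,\gamma)$ is left adjoint to $P^{\mathrm{ex}}_{\mathrm{pr}_A}$. **Theorem.** The 2-monad $T^{\mathrm{ex}}$ on $\mathbf{SD}_{\exp}$ restricts to a 2-monad on $\mathbf{UD}_{\exp}$. Explicitly: if $P$ is a universal slat-doctrine with exponents, then so is $P^{\mathrm{ex}}$; if $(F,b)$ is a 1-cell of $\mathbf{UD}_{\exp}$, then $T^{\mathrm{ex}}(F,b)$ preserves the universal structure; for every object $P$ of $\mathbf{UD}_{\exp}$ the unit $\eta_P$ and the multiplication $\mu_P$ preserve the universal structure; and there is a 2-monad on $\mathbf{UD}_{\exp}$ whose underlying 2-functor, unit and multiplication correspond strictly to those of $T^{\mathrm{ex}}$ under the inclusion $\mathbf{UD}_{\exp}\hookrightarrow\mathbf{SD}_{\exp}$. -/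

import Mathlib

open CategoryTheory MonoidalCategory CartesianMonoidalCategory Opposite

universe v u w₁ v₁ u₁ w₂ v₂ u₂

section TwoMonads
open Bicategory

variable {B : Type u₁} [Bicategory.{w₁, v₁} B] {C : Type u₂} [Bicategory.{w₂, v₂} C]

lemma map₂_wl (F : StrictPseudofunctor B C) {X Y Z : B} (f : X ⟶ Y) {g g' : Y ⟶ Z} (t : g ⟶ g') :
    F.map₂ (f ◁ t) = eqToHom (F.map_comp f g) ≫ F.map f ◁ F.map₂ t ≫
      eqToHom (F.map_comp f g').symm := by
  simp [F.map₂_whisker_left, F.mapComp_eq_eqToIso]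

lemma map₂_wr (F : StrictPseudofunctor B C) {X Y Z : B} {f f' : X ⟶ Y} (t : f ⟶ f') (g : Y ⟶ Z) :
    F.map₂ (t ▷ g) = eqToHom (F.map_comp f g) ≫ F.map₂ t ▷ F.map g ≫
      eqToHom (F.map_comp f' g).symm := by
  simp [F.map₂_whisker_right, F.mapComp_eq_eqToIso]

/-- A strict 2-natural transformation between strict 2-functors. -/
structure StrictTrans (F G : StrictPseudofunctor B C) where
  app : ∀ X : B, F.obj X ⟶ G.obj X
  naturality : ∀ {X Y : B} (f : X ⟶ Y), F.map f ≫ app Y = app X ≫ G.map f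
  naturality₂ : ∀ {X Y : B} {f g : X ⟶ Y} (t : f ⟶ g),
    F.map₂ t ▷ app Y =
      eqToHom (naturality f) ≫ app X ◁ G.map₂ t ≫ eqToHom (naturality g).symm

variable (B) in
/-- A (strict) 2-monad on a strict 2-category: a strict 2-functor `T` with strict 2-natural
transformations `unit : 1 ⟶ T` and `mul : T T ⟶ T` satisfying the unit and associativity laws. -/
structure TwoMonad [Strict B] where
  T : StrictPseudofunctor B B
  unit : StrictTrans (StrictPseudofunctor.id B) T
  mul : StrictTrans (T.comp T) T
  unit_mul : ∀ X : B, (show T.obj X ⟶ T.obj (T.obj X) from unit.app (T.obj X)) ≫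
    (show T.obj (T.obj X) ⟶ T.obj X from mul.app X) = 𝟙 (T.obj X)
  map_unit_mul : ∀ X : B, (show T.obj X ⟶ T.obj (T.obj X) from T.map (unit.app X)) ≫
    (show T.obj (T.obj X) ⟶ T.obj X from mul.app X) = 𝟙 (T.obj X)
  assoc : ∀ X : B,
    (show T.obj (T.obj (T.obj X)) ⟶ T.obj (T.obj X) from T.map (mul.app X)) ≫
      (show T.obj (T.obj X) ⟶ T.obj X from mul.app X) =
    (show T.obj (T.obj (T.obj X)) ⟶ T.obj (T.obj X) from mul.app (T.obj X)) ≫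
      (show T.obj (T.obj X) ⟶ T.obj X from mul.app X)

/-- `T'` on `B` is a lifting of `T` on `C` along the strict 2-functor `J : B ⥤ C`: the underlying
2-functors, units and multiplications correspond strictly under `J`. -/
structure TwoMonad.Lifts [Strict B] [Strict C] (T' : TwoMonad B) (T : TwoMonad C) (J : StrictPseudofunctor B C) :
    Prop where
  obj : ∀ X, J.obj (T'.T.obj X) = T.T.obj (J.obj X)
  map : ∀ {X Y : B} (f : X ⟶ Y), HEq (J.map (T'.T.map f)) (T.T.map (J.map f))
  map₂ : ∀ {X Y : B} {f g : X ⟶ Y} (t : f ⟶ g),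
    HEq (J.map₂ (T'.T.map₂ t)) (T.T.map₂ (J.map₂ t))
  unit : ∀ X, HEq (J.map (T'.unit.app X)) (T.unit.app (J.obj X))
  mul : ∀ X, HEq (J.map (T'.mul.app X)) (T.mul.app (J.obj X))

variable (B) in
/-- A 2-full sub-2-category: a class of objects and a class of 1-cells between them, closed under
identities and composition; all 2-cells between these 1-cells are kept. -/
structure SubTwoCat where
  obj : B → Prop
  hom : ∀ {X Y : B}, (X ⟶ Y) → Prop
  id_mem : ∀ {X : B}, obj X → hom (𝟙 X)
  comp_mem : ∀ {X Y Z : B} {f : X ⟶ Y} {g : Y ⟶ Z}, obj X → obj Y → obj Z →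
    hom f → hom g → hom (f ≫ g)

namespace SubTwoCat
variable (S : SubTwoCat B)

/-- The objects of a 2-full sub-2-category. -/
structure Carrier where
  obj : B
  property : S.obj obj

variable {S}

/-- The 1-cells of a 2-full sub-2-category. -/
@[ext]
structure Hom (X Y : S.Carrier) where
  hom : X.obj ⟶ Y.obj
  property : S.hom hom

instance : CategoryStruct S.Carrier where
  Hom := Hom
  id X := ⟨𝟙 X.obj, S.id_mem X.property⟩
  comp {X Y Z} f g :=
    ⟨f.hom ≫ g.hom, S.comp_mem X.property Y.property Z.property f.property g.property⟩

/-- The 2-cells of a 2-full sub-2-category. -/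
@[ext]
structure Hom₂ {X Y : S.Carrier} (f g : X ⟶ Y) where
  hom₂ : Hom.hom f ⟶ Hom.hom g

instance (X Y : S.Carrier) : Category (X ⟶ Y) where
  Hom := Hom₂
  id f := ⟨𝟙 (Hom.hom f)⟩
  comp s t := ⟨s.hom₂ ≫ t.hom₂⟩
  id_comp _ := Hom₂.ext (Category.id_comp _)
  comp_id _ := Hom₂.ext (Category.comp_id _)
  assoc _ _ _ := Hom₂.ext (Category.assoc _ _ _)

/-- An invertible 2-cell of the ambient 2-category gives one of the sub-2-category. -/
def isoMk {X Y : S.Carrier} {f g : X ⟶ Y} (e : Hom.hom f ≅ Hom.hom g) : f ≅ g where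
  hom := Hom₂.mk e.hom
  inv := Hom₂.mk e.inv
  hom_inv_id := Hom₂.ext e.hom_inv_id
  inv_hom_id := Hom₂.ext e.inv_hom_id

instance : Bicategory S.Carrier where
  homCategory := inferInstance
  whiskerLeft f g h t := Hom₂.mk (f := f ≫ g) (g := f ≫ h) (Hom.hom f ◁ Hom₂.hom₂ t)
  whiskerRight {_ _ _ f g} t h := Hom₂.mk (f := f ≫ h) (g := g ≫ h) (Hom₂.hom₂ t ▷ Hom.hom h)
  associator f g h := isoMk (α_ (Hom.hom f) (Hom.hom g) (Hom.hom h))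
  leftUnitor f := isoMk (λ_ (Hom.hom f))
  rightUnitor f := isoMk (ρ_ (Hom.hom f))
  whiskerLeft_id _ _ := Hom₂.ext (Bicategory.whiskerLeft_id _ _)
  whiskerLeft_comp _ _ _ _ _ _ := Hom₂.ext (Bicategory.whiskerLeft_comp _ _ _)
  id_whiskerLeft _ := Hom₂.ext (Bicategory.id_whiskerLeft _)
  comp_whiskerLeft _ _ _ _ _ := Hom₂.ext (Bicategory.comp_whiskerLeft _ _ _)
  id_whiskerRight _ _ := Hom₂.ext (Bicategory.id_whiskerRight _ _)
  comp_whiskerRight _ _ _ := Hom₂.ext (Bicategory.comp_whiskerRight _ _ _)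
  whiskerRight_id _ := Hom₂.ext (Bicategory.whiskerRight_id _)
  whiskerRight_comp _ _ _ := Hom₂.ext (Bicategory.whiskerRight_comp _ _ _)
  whisker_assoc _ _ _ _ _ := Hom₂.ext (Bicategory.whisker_assoc _ _ _)
  whisker_exchange _ _ := Hom₂.ext (Bicategory.whisker_exchange _ _)
  pentagon _ _ _ _ := Hom₂.ext (Bicategory.pentagon _ _ _ _)
  triangle _ _ := Hom₂.ext (Bicategory.triangle _ _)

lemma eqToHom_hom₂ {X Y : S.Carrier} {f g : X ⟶ Y} (h : f = g) :
    Hom₂.hom₂ (eqToHom h) = eqToHom (congrArg Hom.hom h) := by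
  subst h; rfl

lemma eqToHom_comp_hom₂ {X Y : S.Carrier} {f f' g g' : X ⟶ Y} (h : f = f') (h' : g = g')
    {t : f' ⟶ g} {s : Hom.hom f ⟶ Hom.hom g'} (e : Hom.hom f = Hom.hom f')
    (e' : Hom.hom g = Hom.hom g')
    (hs : s = eqToHom e ≫ Hom₂.hom₂ t ≫ eqToHom e') :
    s = Hom₂.hom₂ (eqToHom h ≫ t ≫ eqToHom h') := by
  subst h h'
  simpa using hs

lemma isoMk_eqToIso {X Y : S.Carrier} {f g : X ⟶ Y} (h : Hom.hom f = Hom.hom g) (h' : f = g) :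
    isoMk (eqToIso h) = eqToIso h' := by
  subst h'; rfl

instance [Strict B] : Strict S.Carrier where
  id_comp f := Hom.ext (Strict.id_comp (Hom.hom f))
  comp_id f := Hom.ext (Strict.comp_id (Hom.hom f))
  assoc f g h := Hom.ext (Strict.assoc (Hom.hom f) (Hom.hom g) (Hom.hom h))
  leftUnitor_eqToIso f :=
    (congrArg isoMk (Strict.leftUnitor_eqToIso (Hom.hom f))).trans (isoMk_eqToIso _ _)
  rightUnitor_eqToIso f :=
    (congrArg isoMk (Strict.rightUnitor_eqToIso (Hom.hom f))).trans (isoMk_eqToIso _ _)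
  associator_eqToIso f g h :=
    (congrArg isoMk (Strict.associator_eqToIso (Hom.hom f) (Hom.hom g) (Hom.hom h))).trans
      (isoMk_eqToIso _ _)

variable (S) in
/-- The inclusion 2-functor of a 2-full sub-2-category. -/
def incl [Strict B] : StrictPseudofunctor S.Carrier B :=
  StrictPseudofunctor.mk''
    { obj := Carrier.obj
      map := Hom.hom
      map₂ := Hom₂.hom₂
      map₂_id := fun _ => rfl
      map₂_comp := fun _ _ => rfl
      map_id := fun _ => rfl
      map_comp := fun _ _ => rfl
      map₂_whisker_left := fun _ _ _ _ => by
        simp only [eqToHom_refl, Category.id_comp, Category.comp_id]; rfl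
      map₂_whisker_right := fun _ _ => by
        simp only [eqToHom_refl, Category.id_comp, Category.comp_id]; rfl }

end SubTwoCat

namespace TwoMonad
variable [Strict B] (T : TwoMonad B) (S : SubTwoCat B)

/-- The 2-monad `T` preserves the sub-2-category `S`: its action on objects and on 1-cells and the
components of its unit and multiplication at objects of `S` stay in `S`. -/
structure Preserves : Prop where
  obj : ∀ X : B, S.obj X → S.obj (T.T.obj X)
  map : ∀ {X Y : B} (f : X ⟶ Y), S.obj X → S.obj Y → S.hom f → S.hom (T.T.map f)
  unit : ∀ X : B, S.obj X → S.hom (T.unit.app X)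
  mul : ∀ X : B, S.obj X → S.hom (T.mul.app X)

variable {T S}

/-- The restriction of the 2-functor underlying a 2-monad to a sub-2-category it preserves. -/
def restrictFunctor (h : T.Preserves S) : StrictPseudofunctor S.Carrier S.Carrier :=
  StrictPseudofunctor.mk''
    { obj := fun X => ⟨T.T.obj X.obj, h.obj _ X.property⟩
      map := fun {X Y} f => SubTwoCat.Hom.mk (T.T.map (SubTwoCat.Hom.hom f))
        (h.map _ X.property Y.property f.property)
      map₂ := fun t => SubTwoCat.Hom₂.mk (T.T.map₂ (SubTwoCat.Hom₂.hom₂ t))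
      map₂_id := fun _ => SubTwoCat.Hom₂.ext (T.T.map₂_id _)
      map₂_comp := fun _ _ => SubTwoCat.Hom₂.ext (T.T.map₂_comp _ _)
      map_id := fun X => SubTwoCat.Hom.ext (T.T.map_id X.obj)
      map_comp := fun _ _ => SubTwoCat.Hom.ext (T.T.map_comp _ _)
      map₂_whisker_left := fun f _ _ t => SubTwoCat.Hom₂.ext
        (SubTwoCat.eqToHom_comp_hom₂ _ _ (T.T.map_comp _ _) (T.T.map_comp _ _).symm
          (map₂_wl T.T (SubTwoCat.Hom.hom f) (SubTwoCat.Hom₂.hom₂ t)))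
      map₂_whisker_right := fun t g => SubTwoCat.Hom₂.ext
        (SubTwoCat.eqToHom_comp_hom₂ _ _ (T.T.map_comp _ _) (T.T.map_comp _ _).symm
          (map₂_wr T.T (SubTwoCat.Hom₂.hom₂ t) (SubTwoCat.Hom.hom g))) }

/-- The restriction of a 2-monad to a sub-2-category it preserves. -/
def restrict (h : T.Preserves S) : TwoMonad S.Carrier where
  T := restrictFunctor h
  unit :=
    { app := fun X => SubTwoCat.Hom.mk (T.unit.app X.obj) (h.unit _ X.property)
      naturality := fun f => SubTwoCat.Hom.ext (T.unit.naturality (SubTwoCat.Hom.hom f))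
      naturality₂ := fun t => SubTwoCat.Hom₂.ext
        (SubTwoCat.eqToHom_comp_hom₂ _ _ (T.unit.naturality _) (T.unit.naturality _).symm
          (T.unit.naturality₂ (SubTwoCat.Hom₂.hom₂ t))) }
  mul :=
    { app := fun X => SubTwoCat.Hom.mk (T.mul.app X.obj) (h.mul _ X.property)
      naturality := fun f => SubTwoCat.Hom.ext (T.mul.naturality (SubTwoCat.Hom.hom f))
      naturality₂ := fun t => SubTwoCat.Hom₂.ext
        (SubTwoCat.eqToHom_comp_hom₂ _ _ (T.mul.naturality _) (T.mul.naturality _).symm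
          (T.mul.naturality₂ (SubTwoCat.Hom₂.hom₂ t))) }
  unit_mul X := SubTwoCat.Hom.ext (T.unit_mul X.obj)
  map_unit_mul X := SubTwoCat.Hom.ext (T.map_unit_mul X.obj)
  assoc X := SubTwoCat.Hom.ext (T.assoc X.obj)

end TwoMonad
end TwoMonads



/-- A slat-doctrine: a functor `P : Cᵒᵖ ⥤ Pos`, where `C` is a category with finite products. -/
structure SlatDoctrine : Type (max (u + 1) (v + 1)) where
  Base : Type u
  [cat : Category.{v} Base]
  [cart : CartesianMonoidalCategory Base]
  P : Baseᵒᵖ ⥤ PartOrd.{u}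

namespace SlatDoctrine

attribute [instance] cat cart

/-- The poset of predicates on an object of the base. -/
abbrev Fib (D : SlatDoctrine.{v, u}) (A : D.Base) : Type u := D.P.obj (op A)

/-- Reindexing `P_f : P(B) → P(A)` along `f : A ⟶ B`. -/
def reindex (D : SlatDoctrine.{v, u}) {A B : D.Base} (f : A ⟶ B) : D.Fib B →o D.Fib A :=
  (D.P.map f.op).hom

section
variable (D : SlatDoctrine.{v, u})

@[simp] lemma reindex_id {A : D.Base} (x : D.Fib A) : D.reindex (𝟙 A) x = x := by
  simp [reindex]

lemma reindex_comp {A B C : D.Base} (f : A ⟶ B) (g : B ⟶ C) (x : D.Fib C) :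
    D.reindex (f ≫ g) x = D.reindex f (D.reindex g x) := by
  simp [reindex]

lemma reindex_eq {A B C : D.Base} {f : A ⟶ B} {g : B ⟶ C} {h : A ⟶ C} (e : f ≫ g = h)
    (x : D.Fib C) : D.reindex f (D.reindex g x) = D.reindex h x := by
  rw [← e, reindex_comp]

end

/-- A 1-cell of slat-doctrines `(F, b)`: a finite-product-preserving functor `F` between the bases
together with a natural transformation `b : P ⟶ R ∘ Fᵒᵖ`. -/
structure Hom (D E : SlatDoctrine.{v, u}) where
  F : D.Base ⥤ E.Base
  [pres : Limits.PreservesFiniteProducts F]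
  b : D.P ⟶ F.op ⋙ E.P

attribute [instance] Hom.pres

namespace Hom
variable {D E : SlatDoctrine.{v, u}}

/-- The component `b_A : P(A) → R(F A)`. -/
def app (f : Hom D E) (A : D.Base) : D.Fib A →o E.Fib (f.F.obj A) := (f.b.app (op A)).hom

lemma app_reindex (f : Hom D E) {A B : D.Base} (g : A ⟶ B) (x : D.Fib B) :
    f.app A (D.reindex g x) = E.reindex (f.F.map g) (f.app B x) :=
  ConcreteCategory.congr_hom (f.b.naturality g.op) x

/-- Build a 1-cell from its components. -/
@[simps F]
def ofApp (F : D.Base ⥤ E.Base) [Limits.PreservesFiniteProducts F]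
    (a : ∀ A, D.Fib A →o E.Fib (F.obj A))
    (h : ∀ {A B : D.Base} (g : A ⟶ B) (x : D.Fib B),
      a A (D.reindex g x) = E.reindex (F.map g) (a B x)) : Hom D E where
  F := F
  b :=
    { app := fun A => PartOrd.ofHom (a A.unop)
      naturality := fun A B g => by ext x; exact h g.unop x }

@[simp] lemma ofApp_app (F : D.Base ⥤ E.Base) [Limits.PreservesFiniteProducts F]
    (a : ∀ A, D.Fib A →o E.Fib (F.obj A)) (h) (A : D.Base) :
    (ofApp (D := D) (E := E) F a h).app A = a A := rfl

/-- Two 1-cells with the same underlying functor agree as soon as their components do. -/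
lemma ext_app {f g : Hom D E} (hF : f.F = g.F)
    (h : ∀ A x, E.reindex (eqToHom (congrArg (fun K => K.obj A) hF)) (g.app A x) = f.app A x) :
    f = g := by
  obtain ⟨F, b⟩ := f
  obtain ⟨F', c⟩ := g
  dsimp only at hF
  subst hF
  have : b = c := by
    ext A x
    exact (h A.unop x).symm.trans (E.reindex_id _)
  subst this
  rfl

end Hom

instance : CategoryStruct SlatDoctrine.{v, u} where
  Hom := Hom
  id D := Hom.ofApp (𝟭 _) (fun _ => OrderHom.id) (fun _ _ => rfl)
  comp {D E G} f g := Hom.ofApp (f.F ⋙ g.F) (fun A => (g.app (f.F.obj A)).comp (f.app A))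
    (fun k x => by simp [Hom.app_reindex])

section
variable {D E G : SlatDoctrine.{v, u}}
@[simp] lemma id_F : Hom.F (𝟙 D) = 𝟭 _ := rfl
@[simp] lemma id_app (A : D.Base) (x : D.Fib A) : Hom.app (𝟙 D) A x = x := rfl
@[simp] lemma comp_F (f : D ⟶ E) (g : E ⟶ G) : Hom.F (f ≫ g) = f.F ⋙ g.F := rfl
@[simp] lemma comp_app (f : D ⟶ E) (g : E ⟶ G) (A : D.Base) (x : D.Fib A) :
    Hom.app (f ≫ g) A x = g.app _ (f.app A x) := rfl
end

/-- A 2-cell `(F, b) ⟶ (G, c)`: a natural transformation `θ : F ⟶ G` such that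
`b_A(α) ≤ R_{θ_A}(c_A(α))`. -/
@[ext]
structure Hom₂ {D E : SlatDoctrine.{v, u}} (f g : D ⟶ E) where
  θ : f.F ⟶ g.F
  le : ∀ (A : D.Base) (α : D.Fib A), f.app A α ≤ E.reindex (θ.app A) (g.app A α)

instance (D E : SlatDoctrine.{v, u}) : Category (D ⟶ E) where
  Hom := Hom₂
  id f := ⟨𝟙 _, fun A α => by simp⟩
  comp {f g h} s t := ⟨s.θ ≫ t.θ, fun A α => by
    rw [NatTrans.comp_app, reindex_comp]
    exact (s.le A α).trans ((E.reindex _).monotone (t.le A α))⟩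
  id_comp _ := Hom₂.ext (Category.id_comp _)
  comp_id _ := Hom₂.ext (Category.comp_id _)
  assoc _ _ _ := Hom₂.ext (Category.assoc _ _ _)

section
variable {D E : SlatDoctrine.{v, u}}
@[ext] lemma hom₂_ext {f g : D ⟶ E} {s t : f ⟶ g}
    (h : ∀ A, (Hom₂.θ s).app A = (Hom₂.θ t).app A) : s = t :=
  Hom₂.ext (NatTrans.ext (funext h))
@[simp] lemma id_θ (f : D ⟶ E) : Hom₂.θ (𝟙 f) = 𝟙 f.F := rfl
@[simp] lemma comp_θ {f g h : D ⟶ E} (s : f ⟶ g) (t : g ⟶ h) :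
    Hom₂.θ (s ≫ t) = s.θ ≫ t.θ := rfl

lemma eqToHom_θ {f g : D ⟶ E} (h : f = g) :
    Hom₂.θ (eqToHom h) = eqToHom (congrArg Hom.F h) := by
  subst h; rfl
end

/-- Left whiskering of 2-cells. -/
def wL {D E G : SlatDoctrine.{v, u}} (f : D ⟶ E) {g h : E ⟶ G} (t : g ⟶ h) : f ≫ g ⟶ f ≫ h :=
  Hom₂.mk (f := f ≫ g) (g := f ≫ h) (Functor.whiskerLeft f.F (Hom₂.θ t))
    (fun A α => Hom₂.le t _ (f.app A α))

/-- Right whiskering of 2-cells. -/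
def wR {D E G : SlatDoctrine.{v, u}} {f g : D ⟶ E} (t : f ⟶ g) (h : E ⟶ G) : f ≫ h ⟶ g ≫ h :=
  Hom₂.mk (f := f ≫ h) (g := g ≫ h) (Functor.whiskerRight (Hom₂.θ t) h.F) (fun A α => by
    have := (h.app (f.F.obj A)).monotone (Hom₂.le t A α)
    rw [Hom.app_reindex] at this
    exact this)

/-- The 2-category of slat-doctrines. -/
instance : Bicategory SlatDoctrine.{v, u} where
  homCategory := inferInstance
  whiskerLeft f _ _ t := wL f t
  whiskerRight t h := wR t h
  associator f g h := eqToIso (C := _ ⟶ _) (show (f ≫ g) ≫ h = f ≫ g ≫ h from rfl)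
  leftUnitor f := eqToIso (C := _ ⟶ _) (show 𝟙 _ ≫ f = f from rfl)
  rightUnitor f := eqToIso (C := _ ⟶ _) (show f ≫ 𝟙 _ = f from rfl)
  whiskerLeft_id _ _ := hom₂_ext fun _ => rfl
  whiskerLeft_comp _ _ _ _ _ _ := hom₂_ext fun _ => rfl
  id_whiskerLeft t := hom₂_ext fun A =>
    ((Category.id_comp _).trans (Category.comp_id ((Hom₂.θ t).app A))).symm
  comp_whiskerLeft f g _ _ t := hom₂_ext fun A =>
    ((Category.id_comp _).trans (Category.comp_id ((Hom₂.θ t).app _))).symm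
  id_whiskerRight _ g := hom₂_ext fun _ => g.F.map_id _
  comp_whiskerRight s t i := hom₂_ext fun _ => i.F.map_comp _ _
  whiskerRight_id t := hom₂_ext fun A =>
    ((Category.id_comp _).trans (Category.comp_id ((Hom₂.θ t).app A))).symm
  whiskerRight_comp t g h := hom₂_ext fun A =>
    ((Category.id_comp _).trans
      (Category.comp_id (h.F.map (g.F.map ((Hom₂.θ t).app A))))).symm
  whisker_assoc f _ _ t h := hom₂_ext fun A =>
    ((Category.id_comp _).trans (Category.comp_id (h.F.map ((Hom₂.θ t).app (f.F.obj A))))).symm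
  whisker_exchange s t := hom₂_ext fun _ => ((Hom₂.θ t).naturality _).symm
  pentagon f g h i := hom₂_ext fun A => by
    have e : i.F.map (𝟙 (h.F.obj (g.F.obj (f.F.obj A)))) = 𝟙 _ := i.F.map_id _
    exact (congrArg (· ≫ 𝟙 _ ≫ 𝟙 _) e).trans
      ((Category.id_comp _).trans (Category.id_comp _ |>.trans (Category.id_comp _).symm))
  triangle f g := hom₂_ext fun A => (Category.id_comp _).trans (g.F.map_id _).symm

instance : Bicategory.Strict SlatDoctrine.{v, u} where
  id_comp _ := rfl
  comp_id _ := rfl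
  assoc _ _ _ := rfl
  leftUnitor_eqToIso _ := rfl
  rightUnitor_eqToIso _ := rfl
  associator_eqToIso _ _ _ := rfl
end SlatDoctrine

namespace SlatDoctrine
section completion
variable (D : SlatDoctrine.{v, u})

/-- The elements `(A, B, α)`, `α ∈ P(A × B)`, from which the existential completion at `A` is
built. -/
structure ExPred (A : D.Base) : Type u where
  ctx : D.Base
  pred : D.Fib (A ⊗ ctx)

/-- `(A, B, α) ≤ (A, C, β)` iff `α ≤ P_{⟨pr_A, f⟩}(β)` for some `f : A × B ⟶ C`. -/
instance (A : D.Base) : Preorder (D.ExPred A) where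
  le x y := ∃ f : A ⊗ x.ctx ⟶ y.ctx, x.pred ≤ D.reindex (lift (fst A x.ctx) f) y.pred
  le_refl x := ⟨snd _ _, by simp⟩
  le_trans x y z := by
    rintro ⟨f, hf⟩ ⟨g, hg⟩
    refine ⟨lift (fst _ _) f ≫ g, hf.trans ?_⟩
    refine ((D.reindex _).monotone hg).trans (le_of_eq (D.reindex_eq ?_ _))
    ext <;> simp

variable {D}

lemma ExPred.le_def {A : D.Base} {x y : D.ExPred A} :
    x ≤ y ↔ ∃ f : A ⊗ x.ctx ⟶ y.ctx, x.pred ≤ D.reindex (lift (fst A x.ctx) f) y.pred := Iff.rfl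

/-- Reindexing: `(C, B, γ) ↦ (A, B, P_{f × 1_B}(γ))` for `f : A ⟶ C`. -/
def ExPred.reindex {A C : D.Base} (f : A ⟶ C) : D.ExPred C →o D.ExPred A where
  toFun x := ⟨x.ctx, D.reindex (f ▷ x.ctx) x.pred⟩
  monotone' := by
    rintro x y ⟨g, hg⟩
    refine ⟨f ▷ x.ctx ≫ g, ((D.reindex _).monotone hg).trans (le_of_eq ?_)⟩
    change D.reindex _ (D.reindex _ _) = D.reindex _ (D.reindex _ _)
    rw [← D.reindex_comp, ← D.reindex_comp]
    congr 2
    ext <;> simp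

variable (D)

/-- The preorder-valued functor `A ↦ {(A, B, α)}`. -/
def exPre : D.Baseᵒᵖ ⥤ Preord.{u} where
  obj A := Preord.of (D.ExPred A.unop)
  map f := Preord.ofHom (ExPred.reindex f.unop)
  map_id A := by
    ext x
    change (ExPred.mk _ _ : D.ExPred _) = x
    cases x
    simp
  map_comp f g := by
    ext x
    change (ExPred.mk _ _ : D.ExPred _) = ExPred.mk _ _
    congr 1
    exact (congrArg (fun k => D.reindex k x.pred) (comp_whiskerRight g.unop f.unop x.ctx)).trans
      (D.reindex_comp _ _ _)

/-- The existential completion `P^ex`: the poset reflection of `A ↦ {(A, B, α)}`. -/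
abbrev ex : SlatDoctrine.{v, u} where
  Base := D.Base
  P := D.exPre ⋙ preordToPartOrd

variable {D}

/-- The class of the triple `(A, B, α)` in `P^ex(A)`. -/
def exMk {A : D.Base} (B : D.Base) (α : D.Fib (A ⊗ B)) : D.ex.Fib A :=
  toAntisymmetrization (α := D.ExPred A) (· ≤ ·) ⟨B, α⟩

lemma exMk_le {A B C : D.Base} {α : D.Fib (A ⊗ B)} {β : D.Fib (A ⊗ C)} :
    exMk B α ≤ exMk C β ↔ ∃ f : A ⊗ B ⟶ C, α ≤ D.reindex (lift (fst A B) f) β := Iff.rfl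

lemma ex_ind {A : D.Base} {p : D.ex.Fib A → Prop} (h : ∀ B α, p (exMk B α)) (x : D.ex.Fib A) :
    p x := Quotient.inductionOn' x fun y => h y.ctx y.pred

@[simp] lemma ex_reindex {A C : D.Base} (f : A ⟶ C) (B : D.Base) (α : D.Fib (C ⊗ B)) :
    D.ex.reindex (A := A) (B := C) f (exMk B α) = exMk B (D.reindex (f ▷ B) α) := rfl

/-- Two triples whose contexts are isomorphic compatibly with the predicates are identified. -/
lemma exMk_eq {A B C : D.Base} {α : D.Fib (A ⊗ B)} {β : D.Fib (A ⊗ C)} (f : A ⊗ B ⟶ C)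
    (g : A ⊗ C ⟶ B) (hf : α ≤ D.reindex (lift (fst A B) f) β)
    (hg : β ≤ D.reindex (lift (fst A C) g) α) : exMk B α = exMk C β :=
  le_antisymm (exMk_le.2 ⟨f, hf⟩) (exMk_le.2 ⟨g, hg⟩)

/-- Define a monotone map out of a fibre of `P^ex` on triples. -/
def exLift {A : D.Base} {X : Type*} [PartialOrder X] (f : D.ExPred A →o X) :
    D.ex.Fib A →o X where
  toFun := fun x => Quotient.liftOn' x f fun _ _ h =>
    le_antisymm (f.monotone h.1) (f.monotone h.2)
  monotone' := fun x y => Quotient.inductionOn₂' x y fun _ _ h => f.monotone h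

@[simp] lemma exLift_mk {A : D.Base} {X : Type*} [PartialOrder X] (f : D.ExPred A →o X)
    (B : D.Base) (α : D.Fib (A ⊗ B)) : exLift f (exMk B α) = f ⟨B, α⟩ := rfl

end completion

section functoriality
variable {D E G : SlatDoctrine.{v, u}}

/-- `(A, B, α) ↦ (F A, F B, R_m(b_{A × B}(α)))`, where `m : F A × F B ⟶ F (A × B)` is the canonical
isomorphism. -/
noncomputable def Hom.exApp (f : D ⟶ E) (A : D.Base) : D.ExPred A →o E.ExPred (f.F.obj A) where
  toFun x := ⟨f.F.obj x.ctx, E.reindex (inv (prodComparison f.F A x.ctx)) (f.app _ x.pred)⟩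
  monotone' := by
    rintro x y ⟨g, hg⟩
    refine ⟨inv (prodComparison f.F A x.ctx) ≫ f.F.map g, ?_⟩
    refine ((E.reindex _).monotone ((f.app _).monotone hg)).trans (le_of_eq ?_)
    rw [f.app_reindex, ← E.reindex_comp]
    refine Eq.trans ?_ (E.reindex_comp _ _ _)
    congr 2
    rw [IsIso.eq_comp_inv, Category.assoc, IsIso.inv_comp_eq]
    ext <;> simp [← Functor.map_comp]

/-- The action of the existential completion on 1-cells. -/
noncomputable def exMap (f : D ⟶ E) : D.ex ⟶ E.ex :=
  Hom.ofApp (D := D.ex) (E := E.ex) f.F (fun (A : D.Base) => exLift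
    ⟨fun x => exMk (f.F.obj x.ctx) (Hom.exApp f A x).pred, fun _ _ h => (Hom.exApp f A).monotone h⟩)
    (fun {A C : D.Base} g x => by
      induction x using ex_ind with
      | h B α =>
      change exMk (f.F.obj B) (E.reindex (inv (prodComparison f.F A B))
          (f.app _ (D.reindex (g ▷ B) α))) =
        exMk (f.F.obj B) (E.reindex (f.F.map g ▷ f.F.obj B)
          (E.reindex (inv (prodComparison f.F C B)) (f.app _ α)))
      rw [f.app_reindex, ← E.reindex_comp, ← E.reindex_comp, prodComparison_inv_natural_whiskerRight])

lemma exMap_mk (f : D ⟶ E) (A B : D.Base) (α : D.Fib (A ⊗ B)) :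
    Hom.app (exMap f) A (exMk B α) =
      exMk (f.F.obj B) (E.reindex (inv (prodComparison f.F A B)) (f.app _ α)) := rfl

/-- The action of the existential completion on 2-cells. -/
noncomputable def exMap₂ {f g : D ⟶ E} (t : f ⟶ g) : exMap f ⟶ exMap g :=
  Hom₂.mk (f := exMap f) (g := exMap g) (Hom₂.θ (f := f) (g := g) t) (fun A x => by
    induction x using ex_ind with
    | h B α =>
    refine exMk_le.2 ⟨snd _ _ ≫ (Hom₂.θ t).app B, ?_⟩
    refine ((E.reindex _).monotone (Hom₂.le t _ α)).trans (le_of_eq ?_)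
    change E.reindex (inv (prodComparison f.F A B)) (E.reindex ((Hom₂.θ t).app _) (g.app _ α)) =
      E.reindex (lift (fst _ _) (snd _ _ ≫ (Hom₂.θ t).app B))
        (E.reindex ((Hom₂.θ t).app A ▷ g.F.obj B)
          (E.reindex (inv (prodComparison g.F A B)) (g.app _ α)))
    rw [← E.reindex_comp, ← E.reindex_comp, ← E.reindex_comp]
    congr 2
    rw [IsIso.eq_comp_inv, Category.assoc, IsIso.inv_comp_eq]
    ext <;> simp)

lemma exMap_id (D : SlatDoctrine.{v, u}) : exMap (𝟙 D) = 𝟙 D.ex :=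
  Hom.ext_app rfl fun (A : D.Base) x => by
    refine (reindex_id _ _).trans ?_
    induction x using ex_ind with
    | h B α =>
    symm
    change exMk B (D.reindex (inv (prodComparison (𝟭 _) A B)) α) = exMk B α
    congr 1
    simp

lemma exMap_comp (f : D ⟶ E) (g : E ⟶ G) : exMap (f ≫ g) = exMap f ≫ exMap g :=
  Hom.ext_app rfl fun (A : D.Base) x => by
    refine (reindex_id _ _).trans ?_
    induction x using ex_ind with
    | h B α =>
    symm
    change exMk (g.F.obj (f.F.obj B)) (G.reindex (inv (prodComparison (f.F ⋙ g.F) A B))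
        (g.app _ (f.app _ α))) =
      exMk (g.F.obj (f.F.obj B)) (G.reindex (inv (prodComparison g.F _ _))
        (g.app _ (E.reindex (inv (prodComparison f.F A B)) (f.app _ α))))
    rw [g.app_reindex, ← G.reindex_comp]
    congr 2
    simp [prodComparison_comp]

lemma comp₃_eqToHom_app {f f' g g' : D ⟶ E} (h : f = f') (h' : g = g') {t : f' ⟶ g}
    (e : f.F = f'.F) (e' : g.F = g'.F) (A : D.Base) :
    (Hom₂.θ (eqToHom h ≫ t ≫ eqToHom h')).app A =
      eqToHom (congrArg (fun K => K.obj A) e) ≫ (Hom₂.θ t).app A ≫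
        eqToHom (congrArg (fun K => K.obj A) e') := by
  subst h h'
  simp

/-- The existential completion as a strict 2-functor on slat-doctrines. -/
noncomputable def exFunctor : StrictPseudofunctor SlatDoctrine.{v, u} SlatDoctrine.{v, u} :=
  StrictPseudofunctor.mk''
    { obj := ex
      map := exMap
      map₂ := exMap₂
      map₂_id := fun {a b} f => hom₂_ext fun _ => rfl
      map₂_comp := fun {a b f g h} s t => hom₂_ext fun _ => rfl
      map_id := exMap_id
      map_comp := exMap_comp
      map₂_whisker_left := fun {a b c} f g g' t => hom₂_ext fun (A : a.Base) => by
        refine Eq.trans ?_ (comp₃_eqToHom_app (D := a.ex) (E := c.ex) (exMap_comp f g)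
          (exMap_comp f g').symm (t := Bicategory.whiskerLeft (exMap f) (exMap₂ t)) rfl rfl A).symm
        exact ((Category.id_comp _).trans (Category.comp_id ((Hom₂.θ t).app (f.F.obj A)))).symm
      map₂_whisker_right := fun {a b c f f'} t g => hom₂_ext fun (A : a.Base) => by
        refine Eq.trans ?_ (comp₃_eqToHom_app (D := a.ex) (E := c.ex) (exMap_comp f g)
          (exMap_comp f' g).symm (t := Bicategory.whiskerRight (exMap₂ t) (exMap g)) rfl rfl A).symm
        exact ((Category.id_comp _).trans (Category.comp_id (g.F.map ((Hom₂.θ t).app A)))).symm }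

end functoriality
end SlatDoctrine

namespace SlatDoctrine

lemma exMk_iso {D : SlatDoctrine.{v, u}} {A B C : D.Base} (e : B ≅ C) {α : D.Fib (A ⊗ B)}
    {β : D.Fib (A ⊗ C)} (h : α = D.reindex (A ◁ e.hom) β) : exMk B α = exMk C β := by
  subst h
  refine exMk_eq (snd _ _ ≫ e.hom) (snd _ _ ≫ e.inv) (le_of_eq ?_) (le_of_eq ?_)
  · congr 2
    ext <;> simp
  · rw [← D.reindex_comp]
    refine ((D.reindex_id β).symm.trans ?_)
    congr 2
    ext <;> simp

/-- The component `α ↦ (A, 1, α)` of the unit, with `P(A)` transported to `P(A × 1)`. -/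
def exUnitApp (D : SlatDoctrine.{v, u}) (A : D.Base) : D.Fib A →o D.ex.Fib A where
  toFun α := exMk (𝟙_ D.Base) (D.reindex (fst A (𝟙_ D.Base)) α)
  monotone' α β h := exMk_le.2 ⟨snd _ _, by
    simpa using (D.reindex (fst A (𝟙_ D.Base))).monotone h⟩

/-- The unit `P ⟶ P^ex`, with the identity as underlying functor. -/
def exUnit (D : SlatDoctrine.{v, u}) : D ⟶ D.ex :=
  Hom.ofApp (D := D) (E := D.ex) (𝟭 D.Base) (D.exUnitApp) (fun {A B} g x => by
    change exMk (𝟙_ _) (D.reindex (fst A (𝟙_ _)) (D.reindex g x)) =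
      exMk (𝟙_ _) (D.reindex (g ▷ 𝟙_ _) (D.reindex (fst B (𝟙_ _)) x))
    rw [← D.reindex_comp, ← D.reindex_comp]
    congr 3
    exact (whiskerRight_fst g (𝟙_ D.Base)).symm)

/-- The left adjoint `∃^ex : P^ex(A × B) → P^ex(A)`, `(A × B, C, γ) ↦ (A, B × C, γ)`. -/
def exSum {D : SlatDoctrine.{v, u}} (A B : D.Base) : D.ex.Fib (A ⊗ B) →o D.ex.Fib A :=
  exLift
    { toFun := fun x => exMk (B ⊗ x.ctx) (D.reindex (α_ A B x.ctx).inv x.pred)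
      monotone' := by
        rintro x y ⟨f, hf⟩
        refine exMk_le.2 ⟨lift (snd _ _ ≫ fst _ _) ((α_ A B x.ctx).inv ≫ f), ?_⟩
        refine ((D.reindex _).monotone hf).trans (le_of_eq ?_)
        rw [← D.reindex_comp, ← D.reindex_comp]
        congr 2
        ext <;> simp }

lemma exSum_mk {D : SlatDoctrine.{v, u}} (A B C : D.Base) (γ : D.Fib ((A ⊗ B) ⊗ C)) :
    exSum A B (exMk C γ) = exMk (B ⊗ C) (D.reindex (α_ A B C).inv γ) := rfl

/-- `∃^ex` is left adjoint to reindexing along the projection `A × B ⟶ A`. -/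
lemma exSum_gc {D : SlatDoctrine.{v, u}} (A B : D.Base) :
    GaloisConnection (exSum A B) (D.ex.reindex (A := A ⊗ B) (B := A) (fst A B)) := by
  intro x y
  induction x using ex_ind with
  | h C γ =>
  induction y using ex_ind with
  | h E δ =>
  rw [exSum_mk]
  constructor
  · intro h
    obtain ⟨f, hf⟩ := exMk_le.1 h
    refine exMk_le.2 ⟨(α_ A B C).hom ≫ f, ?_⟩
    have := (D.reindex (α_ A B C).hom).monotone hf
    rw [← D.reindex_comp, Iso.hom_inv_id, D.reindex_id] at this
    refine this.trans (le_of_eq ?_)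
    change D.reindex _ (D.reindex _ _) = D.reindex _ (D.reindex _ _)
    rw [← D.reindex_comp, ← D.reindex_comp]
    congr 2
    ext <;> simp
  · intro h
    obtain ⟨f, hf⟩ := exMk_le.1 h
    refine exMk_le.2 ⟨(α_ A B C).inv ≫ f, ?_⟩
    refine ((D.reindex (α_ A B C).inv).monotone hf).trans (le_of_eq ?_)
    change D.reindex _ (D.reindex _ (D.reindex _ _)) = D.reindex _ _
    rw [← D.reindex_comp, ← D.reindex_comp]
    congr 2
    ext <;> simp

lemma exSum_reindex {D : SlatDoctrine.{v, u}} {A C : D.Base} (f : A ⟶ C) (B : D.Base)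
    (x : D.ex.Fib (C ⊗ B)) :
    exSum A B (D.ex.reindex (A := A ⊗ B) (B := C ⊗ B) (f ▷ B) x) =
      D.ex.reindex (A := A) (B := C) f (exSum C B x) := by
  induction x using ex_ind with
  | h E γ =>
  change exMk (B ⊗ E) (D.reindex (α_ A B E).inv (D.reindex ((f ▷ B) ▷ E) γ)) =
    exMk (B ⊗ E) (D.reindex (f ▷ (B ⊗ E)) (D.reindex (α_ C B E).inv γ))
  rw [← D.reindex_comp, ← D.reindex_comp]
  congr 2
  simp

/-- The multiplication `(P^ex)^ex ⟶ P^ex`: the identity functor together with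
`(A, B, x) ↦ ∃^ex_{A × B → A}(x)`, for `x ∈ P^ex(A × B)`. -/
def exMul (D : SlatDoctrine.{v, u}) : D.ex.ex ⟶ D.ex :=
  Hom.ofApp (D := D.ex.ex) (E := D.ex) (𝟭 D.Base)
    (fun (A : D.Base) => exLift (D := D.ex)
      { toFun := fun x => exSum A x.ctx x.pred
        monotone' := by
          rintro x y ⟨f, hf⟩
          refine (exSum_gc (D := D) A x.ctx _ _).2 (hf.trans ?_)
          have h := (D.ex.reindex (A := A ⊗ x.ctx) (B := A ⊗ y.ctx)
            (lift (fst A x.ctx) f)).monotone ((exSum_gc (D := D) A y.ctx y.pred _).1 le_rfl)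
          refine h.trans (le_of_eq ?_)
          refine D.ex.reindex_eq (A := A ⊗ x.ctx) (B := A ⊗ y.ctx) (C := A) ?_ _
          exact lift_fst _ _ })
    (fun {A C : D.Base} g x => by
      induction x using ex_ind with
      | h B x => exact exSum_reindex g B x)

lemma exMul_mk (D : SlatDoctrine.{v, u}) (A B : D.Base) (x : D.ex.Fib (A ⊗ B)) :
    Hom.app (exMul D) A (exMk (D := D.ex) B x) = exSum A B x := rfl

section laws
variable {D E : SlatDoctrine.{v, u}}

lemma exUnit_naturality (f : D ⟶ E) : f ≫ exUnit E = exUnit D ≫ exMap f :=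
  Hom.ext_app rfl fun (A : D.Base) x => by
    refine (reindex_id _ _).trans ?_
    change exMk (f.F.obj (𝟙_ _)) (E.reindex (inv (prodComparison f.F A (𝟙_ _)))
      (f.app _ (D.reindex (fst _ _) x))) = exMk (𝟙_ _) (E.reindex (fst _ _) (f.app A x))
    refine exMk_iso (asIso (terminalComparison f.F)) ?_
    rw [f.app_reindex, ← E.reindex_comp, ← E.reindex_comp]
    congr 2
    simp

lemma exMul_naturality (f : D ⟶ E) : exMap (exMap f) ≫ exMul E = exMul D ≫ exMap f :=
  Hom.ext_app rfl fun (A : D.Base) x => by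
    refine (reindex_id _ _).trans ?_
    induction x using ex_ind with
    | h B x =>
    induction x using ex_ind with
    | h C γ =>
    change exMk (f.F.obj (B ⊗ C)) (E.reindex (inv (prodComparison f.F A (B ⊗ C)))
        (f.app _ (D.reindex (α_ A B C).inv γ))) =
      exMk (f.F.obj B ⊗ f.F.obj C) (E.reindex (α_ _ _ _).inv
        (E.reindex (inv (prodComparison f.F A B) ▷ f.F.obj C)
          (E.reindex (inv (prodComparison f.F (A ⊗ B) C)) (f.app _ γ))))
    refine exMk_iso (asIso (prodComparison f.F B C)) ?_
    rw [f.app_reindex, ← E.reindex_comp, ← E.reindex_comp, ← E.reindex_comp, ← E.reindex_comp]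
    congr 2
    rw [IsIso.inv_comp_eq, ← cancel_mono (prodComparison f.F (A ⊗ B) C),
      ← cancel_mono (prodComparison f.F A B ▷ f.F.obj C)]
    ext <;> simp [← Functor.map_comp]

lemma exUnit_exMul (D : SlatDoctrine.{v, u}) : exUnit D.ex ≫ exMul D = 𝟙 D.ex :=
  Hom.ext_app rfl fun (A : D.Base) x => by
    refine (reindex_id _ _).trans ?_
    induction x using ex_ind with
    | h B γ =>
    change exMk B γ = exMk (𝟙_ _ ⊗ B) (D.reindex (α_ _ _ _).inv
      (D.reindex (fst A (𝟙_ _) ▷ B) γ))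
    refine (exMk_iso (λ_ B) ?_).symm
    rw [← D.reindex_comp]
    congr 2
    ext <;> simp [leftUnitor_hom]

lemma exMap_exUnit_exMul (D : SlatDoctrine.{v, u}) : exMap (exUnit D) ≫ exMul D = 𝟙 D.ex :=
  Hom.ext_app rfl fun (A : D.Base) x => by
    refine (reindex_id _ _).trans ?_
    induction x using ex_ind with
    | h B γ =>
    change exMk B γ = exMk (B ⊗ 𝟙_ _) (D.reindex (α_ A B (𝟙_ _)).inv
      (D.reindex (inv (prodComparison (𝟭 _) A B) ▷ (𝟙_ _)) (D.reindex (fst (A ⊗ B) (𝟙_ _)) γ)))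
    refine (exMk_iso (ρ_ B) ?_).symm
    rw [← D.reindex_comp, ← D.reindex_comp]
    congr 2
    refine CartesianMonoidalCategory.hom_ext (X := A) (Y := B) _ _ ?_ ?_ <;>
      simp [rightUnitor_hom]

lemma exMap_exMul_exMul (D : SlatDoctrine.{v, u}) :
    exMap (exMul D) ≫ exMul D = exMul D.ex ≫ exMul D :=
  Hom.ext_app rfl fun (A : D.Base) x => by
    refine (reindex_id _ _).trans ?_
    induction x using ex_ind with
    | h B x =>
    induction x using ex_ind with
    | h C x =>
    induction x using ex_ind with
    | h E γ =>
    change exMk (D := D) (A := A) ((B ⊗ C) ⊗ E)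
        (D.reindex (α_ A (B ⊗ C) E).inv (D.reindex ((α_ A B C).inv ▷ E) γ)) =
      exMk (D := D) (A := A) (B ⊗ (C ⊗ E)) (D.reindex (α_ A B (C ⊗ E)).inv
        (D.reindex (inv (prodComparison (𝟭 _) A B) ▷ (C ⊗ E))
          (D.reindex (α_ (A ⊗ B) C E).inv γ)))
    refine exMk_iso (D := D) (A := A) (α_ B C E) ?_
    rw [← D.reindex_comp, ← D.reindex_comp, ← D.reindex_comp, ← D.reindex_comp]
    congr 2
    ext <;> simp

end laws

/-- The existential completion 2-monad on slat-doctrines. -/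
noncomputable def exMonad : TwoMonad SlatDoctrine.{v, u} where
  T := exFunctor
  unit :=
    { app := exUnit
      naturality := exUnit_naturality
      naturality₂ := fun {a b f g} t => hom₂_ext fun (A : a.Base) => by
        refine Eq.trans ?_ (comp₃_eqToHom_app (D := a) (E := b.ex) (exUnit_naturality f)
          (exUnit_naturality g).symm (t := Bicategory.whiskerLeft (exUnit a) (exMap₂ t)) rfl rfl A).symm
        exact ((Category.id_comp _).trans (Category.comp_id ((Hom₂.θ t).app A))).symm }
  mul :=
    { app := exMul
      naturality := exMul_naturality
      naturality₂ := fun {a b f g} t => hom₂_ext fun (A : a.Base) => by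
        refine Eq.trans ?_ (comp₃_eqToHom_app (D := a.ex.ex) (E := b.ex) (exMul_naturality f)
          (exMul_naturality g).symm (t := Bicategory.whiskerLeft (exMul a) (exMap₂ t)) rfl rfl A).symm
        exact ((Category.id_comp _).trans (Category.comp_id ((Hom₂.θ t).app A))).symm }
  unit_mul := exUnit_exMul
  map_unit_mul := exMap_exUnit_exMul
  assoc := exMap_exMul_exMul

end SlatDoctrine

section exponents
variable {C : Type u} [Category.{v} C] [CartesianMonoidalCategory C]
  {D : Type u} [Category.{v} D] [CartesianMonoidalCategory D]
  {E : Type u} [Category.{v} E] [CartesianMonoidalCategory E]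

/-- A finite-product-preserving functor preserves exponentials if, for all choices of exponentials
in `C` and `D`, the comparison maps `F (B ^ A) ⟶ (F B) ^ (F A)` are isomorphisms. -/
def PreservesExponentials (F : C ⥤ D) [Limits.PreservesFiniteProducts F] : Prop :=
  ∀ (_ : MonoidalClosed C) (_ : MonoidalClosed D), MonoidalClosedFunctor F

lemma preservesExponentials_iff_app (F : C ⥤ D) [Limits.PreservesFiniteProducts F]
    [MonoidalClosed C] [MonoidalClosed D] :
    MonoidalClosedFunctor F ↔ ∀ A B, IsIso ((expComparison F A).natTrans.app B) :=
  ⟨fun _ _ _ => inferInstance, fun h => ⟨fun A => by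
    have := h A
    exact NatIso.isIso_of_isIso_app _⟩⟩

lemma expComparison_unique (F : C ⥤ D) [Limits.PreservesFiniteProducts F]
    [MonoidalClosed C] [MonoidalClosed D] (A B : C)
    (k : F.obj ((ihom A).obj B) ⟶ (ihom (F.obj A)).obj (F.obj B))
    (hk : F.obj A ◁ k ≫ (ihom.ev (F.obj A)).app (F.obj B) =
      inv (prodComparison F _ _) ≫ F.map ((ihom.ev A).app B)) :
    (expComparison F A).natTrans.app B = k := by
  apply MonoidalClosed.uncurry_injective
  rw [uncurry_expComparison, MonoidalClosed.uncurry_eq]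
  exact hk.symm

lemma whiskerLeft_ev_injective (m : MonoidalClosed C) {A B X : C} {f g : X ⟶ (ihom A).obj B}
    (h : A ◁ f ≫ (ihom.ev A).app B = A ◁ g ≫ (ihom.ev A).app B) : f = g := by
  apply MonoidalClosed.uncurry_injective
  rwa [MonoidalClosed.uncurry_eq, MonoidalClosed.uncurry_eq]

lemma expComparison_id_ev (m m' : MonoidalClosed C) (A B : C) :
    A ◁ (@expComparison C _ C _ _ _ (𝟭 C) m m' _ A).natTrans.app B ≫
      (@ihom.ev C _ _ A (m'.closed A)).app B = (@ihom.ev C _ _ A (m.closed A)).app B := by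
  refine (@expComparison_ev C _ C _ _ _ (𝟭 C) m m' _ A B).trans ?_
  simp

lemma preservesExponentials_id : PreservesExponentials (𝟭 C) := by
  have key : ∀ (m m' : MonoidalClosed C) (A B : C),
      (@expComparison C _ C _ _ _ (𝟭 C) m m' _ A).natTrans.app B ≫
        (@expComparison C _ C _ _ _ (𝟭 C) m' m _ A).natTrans.app B = 𝟙 _ := by
    intro m m' A B
    apply whiskerLeft_ev_injective m
    have e : A ◁ 𝟙 ((@ihom C _ _ A (m.closed A)).obj B) ≫
        (@ihom.ev C _ _ A (m.closed A)).app B = (@ihom.ev C _ _ A (m.closed A)).app B := by simp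
    refine Eq.trans ?_ e.symm
    refine (congrArg (· ≫ _) (MonoidalCategory.whiskerLeft_comp A _ _)).trans ?_
    refine (Category.assoc _ _ _).trans ?_
    exact (congrArg (_ ≫ ·) (expComparison_id_ev m' m A B)).trans (expComparison_id_ev m m' A B)
  intro m m'
  refine (@preservesExponentials_iff_app C _ _ C _ _ (𝟭 C) _ m m').2 fun A B => ?_
  exact ⟨⟨_, key m m' A B, key m' m A B⟩⟩

lemma preservesExponentials_comp (F : C ⥤ D) (G : D ⥤ E) [Limits.PreservesFiniteProducts F]
    [Limits.PreservesFiniteProducts G] (hD : Nonempty (MonoidalClosed D))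
    (hF : PreservesExponentials F) (hG : PreservesExponentials G) :
    PreservesExponentials (F ⋙ G) := by
  intro mC mE
  obtain ⟨mD⟩ := hD
  have hF := (preservesExponentials_iff_app F).1 (hF mC mD)
  have hG := (preservesExponentials_iff_app G).1 (hG mD mE)
  refine (preservesExponentials_iff_app (F ⋙ G)).2 fun A B => ?_
  have e := expComparison_unique (F ⋙ G) A B
    (G.map ((expComparison F A).natTrans.app B) ≫
      (expComparison G (F.obj A)).natTrans.app (F.obj B)) (by
    have h₁ := expComparison_ev F A B
    have h₂ := expComparison_ev G (F.obj A) (F.obj B)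
    dsimp only [Functor.comp_obj] at h₁ h₂ ⊢
    rw [MonoidalCategory.whiskerLeft_comp, Category.assoc]
    refine (congrArg (_ ≫ ·) h₂).trans ?_
    rw [← Category.assoc, ← prodComparison_inv_natural_whiskerLeft, Category.assoc,
      ← G.map_comp]
    refine (congrArg (fun k => _ ≫ G.map k) h₁).trans ?_
    simp [prodComparison_comp])
  rw [e]
  have := hF A B
  have := hG (F.obj A) (F.obj B)
  infer_instance

end exponents

namespace SlatDoctrine

/-- `p : X ⟶ A` is a product projection: it exhibits `X` as a product `A × B` for some `B`. -/
def IsProjection {C : Type*} [Category* C] {X A : C} (p : X ⟶ A) : Prop :=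
  ∃ (B : C) (q : X ⟶ B), Nonempty (Limits.IsLimit (Limits.BinaryFan.mk p q))

/-- A slat-doctrine is universal if reindexing along every product projection has a right adjoint,
and these right adjoints satisfy the Beck-Chevalley condition for all pullback squares
of a projection along an arbitrary map, whose opposite side is again a projection. -/
structure IsUniversal (P : SlatDoctrine.{v, u}) : Prop where
  exists_right_adjoint : ∀ {X A : P.Base} (p : X ⟶ A), IsProjection p →
    ∃ r : P.Fib X → P.Fib A, GaloisConnection (P.reindex p) r
  beck_chevalley : ∀ {X' A' X A : P.Base} {f' : X' ⟶ X} {p' : X' ⟶ A'} {p : X ⟶ A} {f : A' ⟶ A},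
    IsPullback f' p' p f → IsProjection p → IsProjection p' →
    ∀ {r : P.Fib X → P.Fib A} {r' : P.Fib X' → P.Fib A'},
      GaloisConnection (P.reindex p) r → GaloisConnection (P.reindex p') r' →
      ∀ β : P.Fib X, P.reindex f (r β) = r' (P.reindex f' β)

/-- A 1-cell `(F, b) : P ⟶ R` preserves the universal structure if
`b_A (∀_p α) = ∀_{F p} (b_X α)` for every product projection `p : X ⟶ A` and every `α ∈ P(X)`;
here `F p` is again a product projection since `F` preserves products. -/
def PreservesUniversal {P R : SlatDoctrine.{v, u}} (f : P ⟶ R) : Prop :=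
  ∀ {X A : P.Base} (p : X ⟶ A), IsProjection p →
    ∀ {r : P.Fib X → P.Fib A} {s : R.Fib (f.F.obj X) → R.Fib (f.F.obj A)},
      GaloisConnection (P.reindex p) r → GaloisConnection (R.reindex (f.F.map p)) s →
      ∀ α : P.Fib X, f.app A (r α) = s (f.app X α)

lemma isProjection_map {C D : Type*} [Category* C] [Category* D] (F : C ⥤ D)
    [Limits.PreservesFiniteProducts F] {X A : C} {p : X ⟶ A} (h : IsProjection p) :
    IsProjection (F.map p) := by
  obtain ⟨B, q, ⟨l⟩⟩ := h
  exact ⟨F.obj B, F.map q, ⟨Limits.mapIsLimitOfPreservesOfIsLimit F p q l⟩⟩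

/-- The base category of `P` has exponents. -/
def HasExponents (P : SlatDoctrine.{v, u}) : Prop := Nonempty (MonoidalClosed P.Base)

/-- The 2-full sub-2-category of slat-doctrines whose base has exponents, with the 1-cells that
preserve exponents. -/
def expSub : SubTwoCat SlatDoctrine.{v, u} where
  obj P := HasExponents P
  hom f := PreservesExponentials f.F
  id_mem _ := preservesExponentials_id
  comp_mem _ h _ hf hg := preservesExponentials_comp _ _ h hf hg

/-- The 2-category of slat-doctrines with exponents. -/
abbrev ExpSD := (expSub.{v, u}).Carrier

lemma exMonad_preserves_expSub : exMonad.Preserves expSub.{v, u} where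
  obj _ h := h
  map _ _ _ h := h
  unit _ h := expSub.id_mem h
  mul _ h := expSub.id_mem h

/-- The existential completion 2-monad on slat-doctrines with exponents. -/
noncomputable def exMonadExp : TwoMonad ExpSD.{v, u} := TwoMonad.restrict exMonad_preserves_expSub

/-- The 2-full sub-2-category of universal slat-doctrines with exponents, with
the 1-cells that preserve the universal structure (and exponents). -/
def univSub : SubTwoCat ExpSD.{v, u} where
  obj P := IsUniversal P.obj
  hom f := PreservesUniversal (SubTwoCat.Hom.hom f)
  id_mem _ := fun _ _ _ _ hr hs α => hr.u_unique hs (fun _ => rfl)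
  comp_mem {_ Q _ f g} _ hQ _ hf hg := fun p hp _ _ hr hs α => by
    obtain ⟨t, ht⟩ := hQ.exists_right_adjoint ((SubTwoCat.Hom.hom f).F.map p) (isProjection_map _ hp)
    exact (congrArg _ (hf p hp hr ht α)).trans (hg _ (isProjection_map _ hp) ht hs _)

/-- The 2-category of universal slat-doctrines with exponents. -/
abbrev ExpUD := (univSub.{v, u}).Carrier

end SlatDoctrine

/-!
The reason is the Dialectica interpretation of `∀ b ∃ c`. Let `P` be universal with cartesian closed
base, `p : A × B ⟶ A` a projection and `γ ∈ P((A × B) × C)`. A map `(A × B) × D ⟶ C` is the same as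
its transpose `A × D ⟶ C ^ B`, so in the existential completion the right adjoint to reindexing along
`p` sends `(A × B, C, γ)` to `(A, C ^ B, ∀ b, γ(a, b, ev(b, e)))`
(`SlatDoctrine.IsUniversal.isForallAlong_exMk`).

Only the existence of transposes enters the argument, so any weak exponential may replace `C ^ B` in
this formula. Since adjoints between posets are unique, each preservation property reduces to
exhibiting a convenient weak exponential and applying the Beck-Chevalley condition of `P`: the image
`F (C ^ B)` for `T^ex (F, b)`, the terminal object for the unit, and `C ^ B × D ^ B`, as a weak
exponential `(C × D) ^ B`, for the multiplication. The Beck-Chevalley condition of `P^ex` holds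
because the formula is stable under pullback. Finally, a 2-monad which preserves a 2-full
sub-2-category restricts to it.

Right adjoints are handled one value at a time, through the relation `SlatDoctrine.IsForallAlong`,
and product projections `p : X ⟶ A` through a product cone `(p, q)` on `X`, so that no product is
replaced by an isomorphic one.
-/

section Projections

/-! ### Product projections and pullback squares -/

variable {C : Type*} [Category* C]

lemma exists_lift_of_isLimit_binaryFan {A B X : C} {p : X ⟶ A} {q : X ⟶ B}
    (l : Limits.IsLimit (Limits.BinaryFan.mk p q)) {T : C} (a : T ⟶ A) (b : T ⟶ B) :
    ∃ u : T ⟶ X, u ≫ p = a ∧ u ≫ q = b :=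
  ⟨_, (Limits.BinaryFan.IsLimit.lift' l a b).2⟩

lemma hom_ext_of_isLimit_binaryFan {A B X : C} {p : X ⟶ A} {q : X ⟶ B}
    (l : Limits.IsLimit (Limits.BinaryFan.mk p q)) {T : C} {u v : T ⟶ X} (hp : u ≫ p = v ≫ p)
    (hq : u ≫ q = v ≫ q) : u = v :=
  Limits.BinaryFan.IsLimit.hom_ext l hp hq

/-- A square between two product projections which is the identity on the complementary factor
is a pullback. -/
lemma isPullback_of_isLimit_binaryFan {A A' X X' B : C} {p : X ⟶ A} {q : X ⟶ B} {p' : X' ⟶ A'}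
    {q' : X' ⟶ B} (l : Limits.IsLimit (Limits.BinaryFan.mk p q))
    (l' : Limits.IsLimit (Limits.BinaryFan.mk p' q')) {f : A' ⟶ A} {g : X' ⟶ X}
    (hp : g ≫ p = p' ≫ f) (hq : g ≫ q = q') : IsPullback g p' p f := by
  have ex (s : Limits.PullbackCone p f) :=
    exists_lift_of_isLimit_binaryFan l' s.snd (s.fst ≫ q)
  choose u hu₁ hu₂ using ex
  refine ⟨⟨hp⟩, ⟨Limits.PullbackCone.IsLimit.mk _ u (fun s => ?_) hu₁ (fun s m h₁ h₂ => ?_)⟩⟩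
  · refine hom_ext_of_isLimit_binaryFan l ?_ ?_
    · rw [Category.assoc, hp, reassoc_of% hu₁ s, s.condition]
    · rw [Category.assoc, hq, hu₂]
  · refine hom_ext_of_isLimit_binaryFan l' ?_ ?_
    · rw [hu₁, h₂]
    · rw [hu₂, ← hq, ← h₁, Category.assoc]

/-- A pullback of a product projection is a product projection with the same complementary
factor. -/
lemma isLimit_binaryFan_of_isPullback {A A' X X' B : C} {p : X ⟶ A} {q : X ⟶ B} {p' : X' ⟶ A'}
    {f : A' ⟶ A} {g : X' ⟶ X} (h : IsPullback g p' p f)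
    (l : Limits.IsLimit (Limits.BinaryFan.mk p q)) :
    Nonempty (Limits.IsLimit (Limits.BinaryFan.mk p' (g ≫ q))) := by
  have ex {T : C} (a : T ⟶ A') (b : T ⟶ B) :
      ∃ u : T ⟶ X', u ≫ p' = a ∧ u ≫ g ≫ q = b := by
    obtain ⟨w, hw₁, hw₂⟩ := exists_lift_of_isLimit_binaryFan l (a ≫ f) b
    exact ⟨h.lift w a hw₁, h.lift_snd _ _ _, by rw [h.lift_fst_assoc, hw₂]⟩
  choose u hu₁ hu₂ using @ex
  have uniq {T : C} {m m' : T ⟶ X'} (h₁ : m ≫ p' = m' ≫ p') (h₂ : m ≫ g ≫ q = m' ≫ g ≫ q) :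
      m = m' := by
    refine h.hom_ext (hom_ext_of_isLimit_binaryFan l ?_ ?_) h₁
    · rw [Category.assoc, Category.assoc, h.w, reassoc_of% h₁]
    · rw [Category.assoc, Category.assoc, h₂]
  exact ⟨Limits.BinaryFan.IsLimit.mk _ u hu₁ hu₂ fun a b m h₁ h₂ =>
    uniq (h₁.trans (hu₁ a b).symm) (h₂.trans (hu₂ a b).symm)⟩

variable [CartesianMonoidalCategory C]

lemma isLimit_binaryFan_whiskerRight {A X B : C} {p : X ⟶ A} {q : X ⟶ B}
    (l : Limits.IsLimit (Limits.BinaryFan.mk p q)) (D : C) :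
    Nonempty (Limits.IsLimit (Limits.BinaryFan.mk (p ▷ D) (fst X D ≫ q))) :=
  isLimit_binaryFan_of_isPullback (f := fst A D) (g := fst X D)
    ⟨⟨by simp⟩, ⟨Limits.PullbackCone.IsLimit.mk _
      (fun s => lift s.fst (s.snd ≫ snd _ _)) (fun s => by simp)
      (fun s => by ext <;> simp [s.condition])
      (fun s m h₁ h₂ => by ext <;> simp [← h₁, ← h₂])⟩⟩ l

/-- Taking the product of a pullback square of a product projection with a fixed object gives again
a pullback square. -/
lemma isPullback_whiskerRight {A A' X X' : C} {p : X ⟶ A} {p' : X' ⟶ A'} {f : A' ⟶ A}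
    {g : X' ⟶ X} (h : IsPullback g p' p f) (hp : SlatDoctrine.IsProjection p) (D : C) :
    IsPullback (g ▷ D) (p' ▷ D) (p ▷ D) (f ▷ D) := by
  obtain ⟨B, q, ⟨l⟩⟩ := hp
  obtain ⟨l'⟩ := isLimit_binaryFan_of_isPullback h l
  obtain ⟨m⟩ := isLimit_binaryFan_whiskerRight l D
  obtain ⟨m'⟩ := isLimit_binaryFan_whiskerRight l' D
  refine isPullback_of_isLimit_binaryFan m m' ?_ (by simp)
  rw [← comp_whiskerRight, ← comp_whiskerRight, h.w]

lemma SlatDoctrine.IsProjection.whiskerRight {A X : C} {p : X ⟶ A}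
    (hp : SlatDoctrine.IsProjection p) (D : C) : SlatDoctrine.IsProjection (p ▷ D) := by
  obtain ⟨B, q, ⟨l⟩⟩ := hp
  exact ⟨B, _, isLimit_binaryFan_whiskerRight l D⟩

/-! ### Weak exponentials -/

/-- `ev : B × E ⟶ C` exhibits `E` as a weak exponential `C ^ B`: every `B × D ⟶ C` has a
transpose `D ⟶ E`, not required to be unique. -/
def IsWeakExponential {B E Y : C} (ev : B ⊗ E ⟶ Y) : Prop :=
  ∀ ⦃D : C⦄ (g : B ⊗ D ⟶ Y), ∃ k : D ⟶ E, B ◁ k ≫ ev = g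

lemma isWeakExponential_ev [MonoidalClosed C] (B Y : C) :
    IsWeakExponential ((ihom.ev B).app Y) := fun _ g =>
  ⟨MonoidalClosed.curry g, by rw [← MonoidalClosed.uncurry_eq, MonoidalClosed.uncurry_curry]⟩

lemma isWeakExponential_toUnit (B : C) : IsWeakExponential (toUnit (B ⊗ 𝟙_ C)) :=
  fun _ _ => ⟨toUnit _, toUnit_unique _ _⟩

/-- The law `(Y₁ × Y₂) ^ B = Y₁ ^ B × Y₂ ^ B`. -/
lemma IsWeakExponential.prod {B E₁ E₂ Y₁ Y₂ : C} {ev₁ : B ⊗ E₁ ⟶ Y₁} {ev₂ : B ⊗ E₂ ⟶ Y₂}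
    (h₁ : IsWeakExponential ev₁) (h₂ : IsWeakExponential ev₂) :
    IsWeakExponential (lift (B ◁ fst E₁ E₂ ≫ ev₁) (B ◁ snd E₁ E₂ ≫ ev₂)) := by
  intro D g
  obtain ⟨k₁, e₁⟩ := h₁ (g ≫ fst _ _)
  obtain ⟨k₂, e₂⟩ := h₂ (g ≫ snd _ _)
  refine ⟨lift k₁ k₂, ?_⟩
  ext
  · simp only [Category.assoc, lift_fst]
    rw [← whiskerLeft_comp_assoc, lift_fst, e₁]
  · simp only [Category.assoc, lift_snd]
    rw [← whiskerLeft_comp_assoc, lift_snd, e₂]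

/-- A functor preserving exponentials sends evaluations to weak exponentials. -/
lemma PreservesExponentials.isWeakExponential {C D : Type u} [Category.{v} C]
    [CartesianMonoidalCategory C] [Category.{v} D] [CartesianMonoidalCategory D] {F : C ⥤ D}
    [Limits.PreservesFiniteProducts F] (hF : PreservesExponentials F) [mC : MonoidalClosed C]
    [mD : MonoidalClosed D] (B Y : C) :
    IsWeakExponential (inv (prodComparison F B ((ihom B).obj Y)) ≫
      F.map ((ihom.ev B).app Y)) := by
  intro T g
  have := (preservesExponentials_iff_app F).1 (hF mC mD) B Y
  obtain ⟨k, hk⟩ := isWeakExponential_ev (F.obj B) (F.obj Y) g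
  refine ⟨k ≫ inv ((expComparison F B).natTrans.app Y), ?_⟩
  rw [← expComparison_ev, ← hk]
  simp only [← MonoidalCategory.whiskerLeft_comp_assoc, Category.assoc, IsIso.inv_hom_id,
    Category.comp_id]

/-- The map `X × E ⟶ X × C`, `(x, e) ↦ (x, ev (q x, e))`. -/
def evalAlong {X B E Y : C} (q : X ⟶ B) (ev : B ⊗ E ⟶ Y) : X ⊗ E ⟶ X ⊗ Y :=
  lift (fst X E) (q ▷ E ≫ ev)

@[simp]
lemma evalAlong_fst {X B E Y : C} (q : X ⟶ B) (ev : B ⊗ E ⟶ Y) :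
    evalAlong q ev ≫ fst X Y = fst X E := lift_fst _ _

@[simp]
lemma evalAlong_snd {X B E Y : C} (q : X ⟶ B) (ev : B ⊗ E ⟶ Y) :
    evalAlong q ev ≫ snd X Y = q ▷ E ≫ ev := lift_snd _ _

lemma whiskerRight_evalAlong {X X' B E Y : C} (g : X' ⟶ X) (q : X ⟶ B) (ev : B ⊗ E ⟶ Y) :
    g ▷ E ≫ evalAlong q ev = evalAlong (g ≫ q) ev ≫ g ▷ Y := by
  ext
  · rw [Category.assoc, evalAlong_fst, Category.assoc, whiskerRight_fst, whiskerRight_fst,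
      ← Category.assoc, evalAlong_fst]
  · simp

/-- Evaluating in `Y₁ ^ B` and then in `Y₂ ^ B` is evaluating in `Y₁ ^ B × Y₂ ^ B`. -/
lemma associator_inv_evalAlong {X B E₁ E₂ Y₁ Y₂ : C} (q : X ⟶ B) (ev₁ : B ⊗ E₁ ⟶ Y₁)
    (ev₂ : B ⊗ E₂ ⟶ Y₂) :
    (α_ X E₁ E₂).inv ≫ evalAlong (fst X E₁ ≫ q) ev₂ ≫ evalAlong q ev₁ ▷ Y₂ =
      evalAlong q (lift (B ◁ fst E₁ E₂ ≫ ev₁) (B ◁ snd E₁ E₂ ≫ ev₂)) ≫ (α_ X Y₁ Y₂).inv := by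
  have e₁ : (α_ X E₁ E₂).inv ≫ fst (X ⊗ E₁) E₂ ≫ q ▷ E₁ = q ▷ (E₁ ⊗ E₂) ≫ B ◁ fst E₁ E₂ := by
    ext <;> simp
  have e₂ : (α_ X E₁ E₂).inv ≫ (fst X E₁ ≫ q) ▷ E₂ = q ▷ (E₁ ⊗ E₂) ≫ B ◁ snd E₁ E₂ := by
    ext <;> simp
  rw [Iso.eq_comp_inv]
  ext
  · simp [evalAlong]
  · simp only [evalAlong, Category.assoc, comp_lift, lift_whiskerRight, associator_hom_snd_fst,
      lift_fst, lift_snd, lift_fst_assoc]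
    rw [reassoc_of% e₁]
  · simp only [evalAlong, Category.assoc, comp_lift, lift_whiskerRight, associator_hom_snd_snd,
      lift_snd]
    rw [reassoc_of% e₂]

lemma prodComparison_inv_map_evalAlong {C' : Type*} [Category* C'] [CartesianMonoidalCategory C']
    (F : C ⥤ C') [Limits.PreservesFiniteProducts F] {X B E Y : C} (q : X ⟶ B)
    (ev : B ⊗ E ⟶ Y) :
    inv (prodComparison F X E) ≫ F.map (evalAlong q ev) =
      evalAlong (F.map q) (inv (prodComparison F B E) ≫ F.map ev) ≫
        inv (prodComparison F X Y) := by
  rw [IsIso.eq_comp_inv, Category.assoc, IsIso.inv_comp_eq]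
  ext
  · rw [Category.assoc, Category.assoc, prodComparison_fst, evalAlong_fst,
      prodComparison_fst, ← F.map_comp, evalAlong_fst]
  · rw [Category.assoc, Category.assoc, prodComparison_snd, evalAlong_snd,
      ← F.map_comp, evalAlong_snd, ← prodComparison_natural_whiskerRight_assoc,
      IsIso.hom_inv_id_assoc, F.map_comp]

end Projections

namespace SlatDoctrine

/-! ### Universal quantification as a relation -/

/-- `y` is the value at `x` of a right adjoint to reindexing along `p`, that is, `y` is `∀_p x`. -/
def IsForallAlong (P : SlatDoctrine.{v, u}) {X A : P.Base} (p : X ⟶ A) (x : P.Fib X)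
    (y : P.Fib A) : Prop :=
  ∀ z : P.Fib A, P.reindex p z ≤ x ↔ z ≤ y

section
variable {P R : SlatDoctrine.{v, u}}

lemma isForallAlong_of_gc {X A : P.Base} {p : X ⟶ A} {r : P.Fib X → P.Fib A}
    (hr : GaloisConnection (P.reindex p) r) (x : P.Fib X) : P.IsForallAlong p x (r x) :=
  fun z => hr z x

lemma IsForallAlong.unique {X A : P.Base} {p : X ⟶ A} {x : P.Fib X} {y y' : P.Fib A}
    (h : P.IsForallAlong p x y) (h' : P.IsForallAlong p x y') : y = y' :=
  le_antisymm ((h' y).1 ((h y).2 le_rfl)) ((h y').1 ((h' y').2 le_rfl))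

lemma IsUniversal.exists_isForallAlong (hP : P.IsUniversal) {X A : P.Base} {p : X ⟶ A}
    (hp : IsProjection p) (x : P.Fib X) : ∃ y, P.IsForallAlong p x y := by
  obtain ⟨r, hr⟩ := hP.exists_right_adjoint p hp
  exact ⟨r x, isForallAlong_of_gc hr x⟩

/-- The Beck-Chevalley condition; that `p'` is a projection follows from the square. -/
lemma IsUniversal.isForallAlong_reindex (hP : P.IsUniversal) {X' A' X A : P.Base} {f' : X' ⟶ X}
    {p' : X' ⟶ A'} {p : X ⟶ A} {f : A' ⟶ A} (h : IsPullback f' p' p f) (hp : IsProjection p)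
    {x : P.Fib X} {y : P.Fib A} (hy : P.IsForallAlong p x y) :
    P.IsForallAlong p' (P.reindex f' x) (P.reindex f y) := by
  have hp' : IsProjection p' := by
    obtain ⟨B, q, ⟨l⟩⟩ := hp
    exact ⟨B, _, isLimit_binaryFan_of_isPullback h l⟩
  obtain ⟨r, hr⟩ := hP.exists_right_adjoint p hp
  obtain ⟨r', hr'⟩ := hP.exists_right_adjoint p' hp'
  rw [hy.unique (isForallAlong_of_gc hr x), hP.beck_chevalley h hp hp' hr hr']
  exact isForallAlong_of_gc hr' _

lemma PreservesUniversal.isForallAlong (hP : P.IsUniversal) (hR : R.IsUniversal) {f : P ⟶ R}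
    (hf : PreservesUniversal f) {X A : P.Base} {p : X ⟶ A} (hp : IsProjection p) {x : P.Fib X}
    {y : P.Fib A} (hy : P.IsForallAlong p x y) :
    R.IsForallAlong (f.F.map p) (f.app X x) (f.app A y) := by
  obtain ⟨r, hr⟩ := hP.exists_right_adjoint p hp
  obtain ⟨s, hs⟩ := hR.exists_right_adjoint (f.F.map p) (isProjection_map _ hp)
  rw [hy.unique (isForallAlong_of_gc hr x), hf p hp hr hs]
  exact isForallAlong_of_gc hs _

/-- It suffices to check preservation on one universal quantification of each predicate. -/
lemma preservesUniversal_of_isForallAlong {f : P ⟶ R}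
    (h : ∀ {X A : P.Base} (p : X ⟶ A), IsProjection p → ∀ x : P.Fib X, ∃ y,
      P.IsForallAlong p x y ∧ R.IsForallAlong (f.F.map p) (f.app X x) (f.app A y)) :
    PreservesUniversal f := by
  intro X A p hp r s hr hs x
  obtain ⟨y, hy, hy'⟩ := h p hp x
  rw [(isForallAlong_of_gc hr x).unique hy]
  exact hy'.unique (isForallAlong_of_gc hs _)

/-- It suffices to check universality on one universal quantification of each predicate. -/
lemma isUniversal_of_isForallAlong
    (h : ∀ {X A : P.Base} (p : X ⟶ A), IsProjection p → ∀ x : P.Fib X, ∃ y,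
      P.IsForallAlong p x y ∧ ∀ {X' A' : P.Base} {f' : X' ⟶ X} {p' : X' ⟶ A'} {f : A' ⟶ A},
        IsPullback f' p' p f → P.IsForallAlong p' (P.reindex f' x) (P.reindex f y)) :
    P.IsUniversal where
  exists_right_adjoint p hp := by
    choose r hr using fun x => h p hp x
    exact ⟨r, fun z x => (hr x).1 z⟩
  beck_chevalley {X' A' X A f' p' p f} sq hp _ r r' hr hr' β := by
    obtain ⟨y, hy, hy'⟩ := h p hp β
    rw [(isForallAlong_of_gc hr β).unique hy]
    exact (hy' sq).unique (isForallAlong_of_gc hr' _)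

/-! ### Universal quantification in the existential completion -/

/-- The Dialectica formula `∀ b ∃ c, γ ⟺ ∃ e ∀ b, γ (b, ev (b, e))` for universal quantification
in the existential completion, `e` ranging over a weak exponential. -/
lemma IsUniversal.isForallAlong_exMk (hP : P.IsUniversal) {X A B C E : P.Base} {p : X ⟶ A}
    {q : X ⟶ B} (l : Limits.IsLimit (Limits.BinaryFan.mk p q)) {ev : B ⊗ E ⟶ C}
    (hev : IsWeakExponential ev) {γ : P.Fib (X ⊗ C)} {y : P.Fib (A ⊗ E)}
    (hy : P.IsForallAlong (p ▷ E) (P.reindex (evalAlong q ev) γ) y) :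
    P.ex.IsForallAlong (X := X) (A := A) p (exMk C γ) (exMk E y) := by
  have hp : IsProjection p := ⟨B, q, ⟨l⟩⟩
  -- A map `k : A × D ⟶ E` witnesses the right-hand inequality iff its transpose witnesses the left.
  have key : ∀ {D : P.Base} (δ : P.Fib (A ⊗ D)) (k : A ⊗ D ⟶ E),
      P.reindex (p ▷ D) δ ≤ P.reindex (lift (fst X D) (lift (fst X D ≫ q) (p ▷ D ≫ k) ≫ ev)) γ ↔
        δ ≤ P.reindex (lift (fst A D) k) y := by
    intro D δ k
    obtain ⟨m⟩ := isLimit_binaryFan_whiskerRight l E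
    obtain ⟨m'⟩ := isLimit_binaryFan_whiskerRight l D
    have sq : IsPullback (lift (fst X D) (p ▷ D ≫ k)) (p ▷ D) (p ▷ E) (lift (fst A D) k) :=
      isPullback_of_isLimit_binaryFan m m' (by ext <;> simp) (by simp)
    rw [← hP.isForallAlong_reindex sq (hp.whiskerRight E) hy δ, ← P.reindex_comp]
    have e : lift (fst X D) (p ▷ D ≫ k) ≫ evalAlong q ev =
        lift (fst X D) (lift (fst X D ≫ q) (p ▷ D ≫ k) ≫ ev) := by
      ext
      · simp
      · simp only [Category.assoc, evalAlong_snd, lift_snd, lift_whiskerRight_assoc]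
    rw [e]
  intro z
  induction z using ex_ind with
  | h D δ =>
  constructor
  · intro h
    obtain ⟨h, hh⟩ := exMk_le.1 h
    obtain ⟨u, hu₁, hu₂⟩ := exists_lift_of_isLimit_binaryFan l
      (snd B (A ⊗ D) ≫ fst A D) (fst B (A ⊗ D))
    obtain ⟨k, hk⟩ := hev (lift u (snd _ _ ≫ snd _ _) ≫ h)
    refine exMk_le.2 ⟨k, (key δ k).1 (hh.trans (le_of_eq ?_))⟩
    -- `u` rebuilds a point of `X` from its two components.
    have e : lift (fst X D ≫ q) (p ▷ D) ≫ u = fst X D := by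
      refine hom_ext_of_isLimit_binaryFan l ?_ ?_
      · simp [hu₁]
      · simp [hu₂]
    have e' : lift (fst X D ≫ q) (p ▷ D ≫ k) ≫ ev = h := by
      have : lift (fst X D ≫ q) (p ▷ D ≫ k) = lift (fst X D ≫ q) (p ▷ D) ≫ B ◁ k := by simp
      rw [this, Category.assoc, hk, ← Category.assoc, comp_lift, e]
      simp
    rw [e']
  · intro h
    obtain ⟨k, hk⟩ := exMk_le.1 h
    exact exMk_le.2 ⟨_, (key δ k).2 hk⟩

lemma IsUniversal.ex (hP : P.IsUniversal) (hE : HasExponents P) : P.ex.IsUniversal := by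
  obtain ⟨mP⟩ := hE
  refine isUniversal_of_isForallAlong fun {X A : P.Base} p hp x => ?_
  induction x using ex_ind with
  | h C γ =>
  obtain ⟨B, q, ⟨l⟩⟩ := id hp
  obtain ⟨y, hy⟩ := hP.exists_isForallAlong (hp.whiskerRight ((ihom B).obj C))
    (P.reindex (evalAlong q ((ihom.ev B).app C)) γ)
  refine ⟨exMk _ y, hP.isForallAlong_exMk l (isWeakExponential_ev B C) hy, ?_⟩
  intro (X' : P.Base) (A' : P.Base) f' p' f sq
  obtain ⟨l'⟩ := isLimit_binaryFan_of_isPullback sq l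
  refine hP.isForallAlong_exMk l' (isWeakExponential_ev B C) ?_
  have := hP.isForallAlong_reindex (isPullback_whiskerRight sq hp ((ihom B).obj C))
    (hp.whiskerRight _) hy
  have e : f' ▷ (ihom B).obj C ≫ evalAlong q ((ihom.ev B).app C) =
      evalAlong (f' ≫ q) ((ihom.ev B).app C) ≫ f' ▷ C := whiskerRight_evalAlong _ _ _
  rw [← P.reindex_comp, e, P.reindex_comp] at this
  exact this

/-! ### The 2-monad and the universal structure -/

/-- Both sides are given by the Dialectica formula, the right-hand one with the weak exponential
`F (C ^ B)`; they agree because `(F, b)` preserves the quantifier along `p × 1` in that formula. -/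
lemma PreservesUniversal.exMap (hP : P.IsUniversal) (hR : R.IsUniversal) (hPE : HasExponents P)
    (hRE : HasExponents R) {f : P ⟶ R} (hF : PreservesExponentials f.F)
    (hf : PreservesUniversal f) : PreservesUniversal (exMap f) := by
  obtain ⟨mP⟩ := hPE
  obtain ⟨mR⟩ := hRE
  refine preservesUniversal_of_isForallAlong (P := P.ex) (R := R.ex) (f := SlatDoctrine.exMap f)
    fun {X A : P.Base} p hp x => ?_
  induction x using ex_ind with
  | h C γ =>
  obtain ⟨B, q, ⟨l⟩⟩ := id hp
  let E : P.Base := (ihom B).obj C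
  obtain ⟨y, hy⟩ := hP.exists_isForallAlong (hp.whiskerRight E)
    (P.reindex (evalAlong q ((ihom.ev B).app C)) γ)
  refine ⟨exMk E y, hP.isForallAlong_exMk l (isWeakExponential_ev B C) hy, ?_⟩
  have l' := Limits.mapIsLimitOfPreservesOfIsLimit f.F p q l
  refine hR.isForallAlong_exMk l' (hF.isWeakExponential B C) ?_
  have sq : IsPullback (inv (prodComparison f.F X E)) (f.F.map p ▷ f.F.obj E) (f.F.map (p ▷ E))
      (inv (prodComparison f.F A E)) :=
    IsPullback.of_horiz_isIso ⟨prodComparison_inv_natural_whiskerRight f.F p⟩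
  have h := hR.isForallAlong_reindex sq (isProjection_map f.F (hp.whiskerRight E))
    (hf.isForallAlong hP hR (hp.whiskerRight E) hy)
  have e := prodComparison_inv_map_evalAlong f.F q ((ihom.ev B).app C)
  rw [f.app_reindex, ← R.reindex_comp, e, R.reindex_comp] at h
  exact h

/-- With trivial context the Dialectica formula may be taken over the weak exponential `1`, where
it reads `∀_{p × 1}`; this is `∀_p` by the Beck-Chevalley condition. -/
lemma IsUniversal.preservesUniversal_exUnit (hP : P.IsUniversal) :
    PreservesUniversal (exUnit P) := by
  refine preservesUniversal_of_isForallAlong fun {X A} p hp x => ?_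
  obtain ⟨y, hy⟩ := hP.exists_isForallAlong hp x
  obtain ⟨B, q, ⟨l⟩⟩ := id hp
  refine ⟨y, hy, hP.isForallAlong_exMk l (isWeakExponential_toUnit B) ?_⟩
  obtain ⟨l'⟩ := isLimit_binaryFan_whiskerRight l (𝟙_ P.Base)
  have h := hP.isForallAlong_reindex
    (isPullback_of_isLimit_binaryFan l l' (whiskerRight_fst p _).symm rfl) hp hy
  rw [← P.reindex_comp, evalAlong_fst]
  exact h

/-- Quantifying in `(P^ex)^ex` applies the Dialectica formula twice, with weak exponentials `C ^ B`
and `D ^ B`; summing the contexts gives the formula for `C × D` over `C ^ B × D ^ B`. -/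
lemma IsUniversal.preservesUniversal_exMul (hP : P.IsUniversal) (hE : HasExponents P) :
    PreservesUniversal (exMul P) := by
  have hPex := hP.ex hE
  obtain ⟨mP⟩ := hE
  refine @preservesUniversal_of_isForallAlong P.ex.ex P.ex (exMul P) ?_
  intro (X : P.Base) (A : P.Base) p hp x
  induction x using ex_ind with
  | h C x =>
  induction x using ex_ind with
  | h D γ =>
  obtain ⟨B, q, ⟨l⟩⟩ := id hp
  let E₁ : P.Base := (ihom B).obj C
  let E₂ : P.Base := (ihom B).obj D
  let ev₁ : B ⊗ E₁ ⟶ C := (ihom.ev B).app C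
  let ev₂ : B ⊗ E₂ ⟶ D := (ihom.ev B).app D
  have h₁ : IsWeakExponential ev₁ := isWeakExponential_ev B C
  have h₂ : IsWeakExponential ev₂ := isWeakExponential_ev B D
  have hp₁ : IsProjection (p ▷ E₁) := hp.whiskerRight E₁
  obtain ⟨l₁⟩ := isLimit_binaryFan_whiskerRight l E₁
  obtain ⟨y, hy⟩ := hP.exists_isForallAlong (hp₁.whiskerRight E₂)
    (P.reindex (evalAlong (fst X E₁ ≫ q) ev₂) (P.reindex (evalAlong q ev₁ ▷ D) γ))
  refine ⟨exMk (D := P.ex) (A := A) E₁ (exMk (D := P) (A := A ⊗ E₁) E₂ y), ?_, ?_⟩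
  · exact hPex.isForallAlong_exMk (P := P.ex) l h₁ (hP.isForallAlong_exMk l₁ h₂ hy)
  · refine hP.isForallAlong_exMk l (h₁.prod h₂) ?_
    have sq : IsPullback (α_ X E₁ E₂).inv (p ▷ (E₁ ⊗ E₂)) ((p ▷ E₁) ▷ E₂) (α_ A E₁ E₂).inv :=
      IsPullback.of_horiz_isIso ⟨by simp⟩
    have h := hP.isForallAlong_reindex sq (hp₁.whiskerRight E₂) hy
    have e := associator_inv_evalAlong q ev₁ ev₂
    rw [← P.reindex_comp, ← P.reindex_comp, Category.assoc, e, P.reindex_comp] at h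
    exact h

lemma exMonadExp_preserves_univSub : exMonadExp.Preserves univSub.{v, u} where
  obj P h := h.ex P.property
  map {P R} f hP hR hf := hf.exMap hP hR P.property R.property f.property
  unit _ h := h.preservesUniversal_exUnit
  mul P h := h.preservesUniversal_exMul P.property

end
end SlatDoctrine

/-- The existential completion 2-monad on slat-doctrines with exponents preserves universality of
objects, its action on 1-cells, unit and multiplication preserve the universal structure, and it
lifts (strictly, along the inclusion) to a 2-monad on universal slat-doctrines with exponents. -/
theorem mainTheorem9 :
    (∀ P : SlatDoctrine.ExpSD.{v, u}, P.obj.IsUniversal →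
      (SlatDoctrine.exMonadExp.T.obj P).obj.IsUniversal) ∧
    (∀ (P R : SlatDoctrine.ExpSD.{v, u}) (f : P ⟶ R), P.obj.IsUniversal → R.obj.IsUniversal →
      SlatDoctrine.PreservesUniversal f.hom →
      SlatDoctrine.PreservesUniversal (SlatDoctrine.exMonadExp.T.map f).hom) ∧
    (∀ P : SlatDoctrine.ExpSD.{v, u}, P.obj.IsUniversal →
      SlatDoctrine.PreservesUniversal (SlatDoctrine.exMonadExp.unit.app P).hom) ∧
    (∀ P : SlatDoctrine.ExpSD.{v, u}, P.obj.IsUniversal →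
      SlatDoctrine.PreservesUniversal (SlatDoctrine.exMonadExp.mul.app P).hom) ∧
    ∃ T' : TwoMonad SlatDoctrine.ExpUD.{v, u},
      T'.Lifts SlatDoctrine.exMonadExp SlatDoctrine.univSub.incl := by
  have h := SlatDoctrine.exMonadExp_preserves_univSub.{v, u}
  exact ⟨h.obj, fun _ _ f => h.map f, h.unit, h.mul, TwoMonad.restrict h,
    { obj := fun _ => rfl
      map := fun _ => HEq.rfl
      map₂ := fun _ => HEq.rfl
      unit := fun _ => HEq.rfl
      mul := fun _ => HEq.rfl }⟩
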